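/- Let $(\Omega,\mathcal A)$ be a measurable space, let $G\subseteq\mathbb R^{\Omega}$ be a class of real-valued functions, and let $\gamma>0$. A probability measure $q$ on $(\Omega,\mathcal A)$ is called admissible for $G$ if $G$ is a $q$-measurable class in the usual sense of empirical process theory: every $g\in G$ is $q$-measurable, and for all $n\in\mathbb N$ and $a\in\mathbb R^n$ the map $(x_1,\dots,x_n)\mapsto\sup_{g\in G}\bigl|\sum_{i=1}^n a_i g(x_i)\bigr|$ is measurable with respect to the completion of $q^n$. (If singletons are measurable, every countably supported distribution is admissible.) The class $G$ satisfies $\gamma$-uniform convergence if for all $\varepsilon,\delta>0$ there is an $m$ such that for every admissible distribution $q$ on $\Omega$ and every $n\ge m$, with probability at least $1-\delta$ over $S=(x_1,\dots,x_n)\sim q^n$, $$\sup_{g\in G}\Bigl|\mathbb E_{x\sim q}[g(x)]-\frac1n\sum_{i=1}^n g(x_i)\Bigr|\le\gamma+\varepsilon ,$$ meaning that the outer $q^n$-probability of the complementary event is at most $\delta$. **Proposition.** Let $\mathcal X$ be a measurable space in which singletons are measurable, let $R\in\mathbb R$, let $\mathcal F\subseteq[-R,R]^{\mathcal X}$, and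 let $\gamma>0$. If $\mathcal F$ satisfies $\gamma$-uniform convergence, then so does its dual class $\mathcal F^\star=\{\delta_x : x\in\mathcal X\}$, the class of functions $\delta_x:\mathcal F\to\mathbb R$, $\delta_x(f)=f(x)$, with respect to every $\sigma$-algebra on $\mathcal F$. -/

import Mathlib

open MeasureTheory
open scoped ENNReal

/-- `G` is a measurable class with respect to the measure `q`: each member of `G` is
`q`-measurable, and for all `n` and all real coefficients `a₁, …, aₙ` the function
`(x₁, …, xₙ) ↦ sup_{g ∈ G} |∑ aᵢ g(xᵢ)|` is measurable for the completion of the product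
measure `qⁿ`. This is the usual measurability assumption on classes of functions in
empirical process theory; it says that the suprema in question are random variables.
The suprema are taken in `[0, ∞]`. -/
structure IsMeasurableClass {Ω : Type*} [MeasurableSpace Ω] (q : Measure Ω)
    (G : Set (Ω → ℝ)) : Prop where
  aemeasurable : ∀ g ∈ G, AEMeasurable g q
  aemeasurable_iSup : ∀ (n : ℕ) (a : Fin n → ℝ),
    AEMeasurable (fun x : Fin n → Ω => ⨆ g ∈ G, ENNReal.ofReal |∑ i, a i * g (x i)|)
      (Measure.pi fun _ : Fin n => q)

/-- `sup_{g ∈ G} |𝔼_{x ∼ q}[g(x)] - (1/n) ∑ g(Sᵢ)|`, as an element of `[0, ∞]`. -/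
noncomputable def supDeviation {Ω : Type*} [MeasurableSpace Ω] (q : Measure Ω)
    (G : Set (Ω → ℝ)) {n : ℕ} (S : Fin n → Ω) : ℝ≥0∞ :=
  ⨆ g ∈ G, ENNReal.ofReal |(∫ x, g x ∂q) - (1 / (n : ℝ)) * ∑ i, g (S i)|

/-- `γ`-uniform convergence of the class `G` of functions on the measurable space `(Ω, 𝒜)`:
for all `ε, δ > 0` there is `m` such that for every distribution `q` on `Ω`
(for which `G` is a measurable class) and every `n ≥ m`, the probability over `S ∼ qⁿ` that
the maximal deviation exceeds `γ + ε` is at most `δ`. -/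
def UniformConvergence {Ω : Type*} (𝒜 : MeasurableSpace Ω) (G : Set (Ω → ℝ)) (γ : ℝ) : Prop :=
  ∀ ε : ℝ, 0 < ε → ∀ δ : ℝ, 0 < δ → ∃ m : ℕ,
    ∀ q : Measure Ω, IsProbabilityMeasure q → IsMeasurableClass q G →
      ∀ n : ℕ, m ≤ n →
        (Measure.pi fun _ : Fin n => q)
          {S : Fin n → Ω | ENNReal.ofReal (γ + ε) < supDeviation q G S} ≤ ENNReal.ofReal δ

/-- The dual class `F* = {δ_x : x ∈ X}` of functions on `F`, where `δ_x(f) = f(x)`. -/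
def dualClass {X : Type*} (F : Set (X → ℝ)) : Set (F → ℝ) :=
  {φ | ∃ x : X, φ = fun f : F => (f : X → ℝ) x}

/-! Both directions pass through a combinatorial dimension: families shattered at two levels `s` and
`s + γ'`, with the same `s` at every point (`LevelShatters`). It is finite for every gap `γ' > γ`
under `γ`-uniform convergence, and for bounded classes this finiteness conversely gives `γ`-uniform
convergence.

Necessity: on the uniform distribution over a large shattered family, some member is at most `s` on
the sample and at least `s + γ'` on all unsampled points, so it deviates by almost `γ'`
(`UniformConvergence.exists_not_levelShatters`). Finitely supported distributions are admissible
since singletons are measurable.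

Duality: as in Assouad's argument, `2 ^ d` functions shattered by the dual class, indexed by the
patterns on `d` points, yield `d` shattered points. Since `s` is constant, the gap is kept
(`LevelShatters.of_dualClass`).

Sufficiency must not lose a factor in the gap. At each level a class is a class of partial Boolean
functions, undefined between `s` and `s + γ'`; disambiguation covers it on `N` points by
quasipolynomially many total functions (`exists_disambiguation`). Combining finitely many levels
covers the class by boxes of side about `γ'` (`exists_box_cover`). The errors `g - l` lie in an
interval of that length, so a difference of two of them costs `γ'` and not `2γ'`. Symmetrization and
Hoeffding's inequality on the box corners finish, as `exp(-cn)` beats the size of the cover. -/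

/-! ### Shattering and disambiguation of partial Boolean classes. -/

/-- A finite set of points is shattered by a class of partial Boolean functions if every
Boolean pattern on it is realized by a member of the class that is defined on all of it. -/
def PartialShatters {Y : Type*} (H : Set (Y → Option Bool)) (S : Finset Y) : Prop :=
  ∀ b : Y → Bool, ∃ h ∈ H, ∀ y ∈ S, h y = some (b y)

open Classical in
/-- The family of finite sets shattered by a class of partial Boolean functions. -/
noncomputable def partialShatterer {Y : Type*} [Fintype Y] (H : Set (Y → Option Bool)) :
    Finset (Finset Y) :=
  Finset.univ.filter (PartialShatters H)

theorem mem_partialShatterer {Y : Type*} [Fintype Y] {H : Set (Y → Option Bool)}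
    {S : Finset Y} : S ∈ partialShatterer H ↔ PartialShatters H S := by
  simp [partialShatterer]

theorem PartialShatters.mono {Y : Type*} {H H' : Set (Y → Option Bool)} (hH : H ⊆ H')
    {S : Finset Y} (h : PartialShatters H S) : PartialShatters H' S := fun b => by
  obtain ⟨f, hf, hfb⟩ := h b
  exact ⟨f, hH hf, hfb⟩

theorem PartialShatters.not_mem_of_label {Y : Type*} {H : Set (Y → Option Bool)} {y : Y}
    {c : Bool} {S : Finset Y} (h : PartialShatters {f ∈ H | f y = some c} S) : y ∉ S := by
  intro hy
  obtain ⟨f, hf, hfb⟩ := h fun _ => !c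
  have h1 := hfb y hy
  rw [hf.2] at h1
  simp at h1

/-- A set shattered under both labels of `y` does not contain `y`, and it remains shattered by `H`
after `y` is added. Sets counted twice on the left are thus paid for by new sets containing `y`. -/
theorem card_partialShatterer_add_le {Y : Type*} [Fintype Y] (H : Set (Y → Option Bool))
    (y : Y) :
    (partialShatterer {f ∈ H | f y = some false}).card +
      (partialShatterer {f ∈ H | f y = some true}).card ≤ (partialShatterer H).card := by
  classical
  set A := partialShatterer {f ∈ H | f y = some false} with hA
  set B := partialShatterer {f ∈ H | f y = some true} with hB
  have hyA : ∀ S ∈ A, y ∉ S := fun S hS => (mem_partialShatterer.1 hS).not_mem_of_label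
  have hyB : ∀ S ∈ B, y ∉ S := fun S hS => (mem_partialShatterer.1 hS).not_mem_of_label
  have hinj : Set.InjOn (fun S : Finset Y => insert y S) (A ∩ B : Finset (Finset Y)) := by
    intro S hS T hT hST
    have h1 := hyA S (Finset.mem_inter.1 hS).1
    have h2 := hyA T (Finset.mem_inter.1 hT).1
    rw [← Finset.erase_insert h1, ← Finset.erase_insert h2]
    exact congrArg (fun U => Finset.erase U y) hST
  have hdisj : Disjoint (A ∪ B) ((A ∩ B).image fun S => insert y S) := by
    rw [Finset.disjoint_left]
    intro S hS hS'
    obtain ⟨T, -, rfl⟩ := Finset.mem_image.1 hS'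
    rcases Finset.mem_union.1 hS with h | h
    · exact hyA _ h (Finset.mem_insert_self _ _)
    · exact hyB _ h (Finset.mem_insert_self _ _)
  rw [← Finset.card_union_add_card_inter, ← Finset.card_image_of_injOn hinj,
    ← Finset.card_union_of_disjoint hdisj]
  refine Finset.card_le_card fun S hS => mem_partialShatterer.2 ?_
  rcases Finset.mem_union.1 hS with h | h
  · rcases Finset.mem_union.1 h with h | h
    · exact (mem_partialShatterer.1 h).mono fun f hf => hf.1
    · exact (mem_partialShatterer.1 h).mono fun f hf => hf.1
  · obtain ⟨T, hT, rfl⟩ := Finset.mem_image.1 h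
    rw [Finset.mem_inter] at hT
    intro b
    have key : ∃ f ∈ H, f y = some (b y) ∧ ∀ x ∈ T, f x = some (b x) := by
      cases hb : b y
      · obtain ⟨f, hf, hfb⟩ := mem_partialShatterer.1 hT.1 b
        exact ⟨f, hf.1, hf.2, hfb⟩
      · obtain ⟨f, hf, hfb⟩ := mem_partialShatterer.1 hT.2 b
        exact ⟨f, hf.1, hf.2, hfb⟩
    obtain ⟨f, hf, hfy, hfT⟩ := key
    exact ⟨f, hf, fun x hx => by
      rcases Finset.mem_insert.1 hx with rfl | hx
      · exact hfy
      · exact hfT x hx⟩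

/-- A class of partial Boolean functions that shatters fewer than `2 ^ k` sets has a
disambiguation by at most `(N + 1) ^ k` total functions on every set of `N` points. -/
theorem exists_disambiguation {Y : Type*} [Fintype Y] (L : Finset Y) :
    ∀ (k : ℕ) (H : Set (Y → Option Bool)), (partialShatterer H).card < 2 ^ k →
      ∃ C : Finset (Y → Bool), C.card ≤ (L.card + 1) ^ k ∧
        ∀ h ∈ H, ∃ c ∈ C, ∀ y ∈ L, ∀ b, h y = some b → c y = b := by
  classical
  induction L using Finset.induction_on with
  | empty => exact fun k H _ => ⟨{fun _ => true}, by simp, fun h _ => by simp⟩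
  | insert a L ha ih =>
    intro k H hk
    cases k with
    | zero =>
      refine ⟨∅, by simp, fun h hh => ?_⟩
      -- Any nonempty class shatters `∅`, so here `H` is empty.
      have h0 : ∅ ∈ partialShatterer H :=
        mem_partialShatterer.2 fun b => ⟨h, hh, by simp⟩
      simp at hk
      simp [hk] at h0
    | succ k =>
      -- One of the two labels at `a` leaves at most half of the shattered sets. Members with that
      -- label are covered with exponent `k`; all others, including those undefined at `a`, may be
      -- given the label `!c`.
      obtain ⟨c, hc⟩ : ∃ c, (partialShatterer {f ∈ H | f a = some c}).card < 2 ^ k := by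
        have h1 := card_partialShatterer_add_le H a
        rw [pow_succ] at hk
        by_contra! hcon
        have h2 := hcon true
        have h3 := hcon false
        omega
      obtain ⟨C₁, hC₁, h₁⟩ := ih (k + 1) H hk
      obtain ⟨C₂, hC₂, h₂⟩ := ih k _ hc
      refine ⟨C₁.image (fun g => Function.update g a (!c)) ∪
        C₂.image (fun g => Function.update g a c), ?_, fun h hh => ?_⟩
      · calc _ ≤ C₁.card + C₂.card := (Finset.card_union_le _ _).trans
              (add_le_add Finset.card_image_le Finset.card_image_le)
          _ ≤ (L.card + 1) ^ (k + 1) + (L.card + 1) ^ k := add_le_add hC₁ hC₂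
          _ = (L.card + 1 + 1) * (L.card + 1) ^ k := by ring
          _ ≤ (L.card + 1 + 1) * (L.card + 1 + 1) ^ k := by gcongr; omega
          _ = ((insert a L).card + 1) ^ (k + 1) := by
              rw [Finset.card_insert_of_notMem ha]; ring
      · have hne : ∀ y ∈ L, y ≠ a := fun y hy h => ha (h ▸ hy)
        by_cases hc' : h a = some c
        · obtain ⟨g, hg, hgh⟩ := h₂ h ⟨hh, hc'⟩
          refine ⟨_, Finset.mem_union_right _ (Finset.mem_image_of_mem _ hg), fun y hy b hb => ?_⟩
          rcases Finset.mem_insert.1 hy with rfl | hy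
          · rw [hc'] at hb
            simpa using hb
          · rw [Function.update_of_ne (hne y hy)]
            exact hgh y hy b hb
        · obtain ⟨g, hg, hgh⟩ := h₁ h hh
          refine ⟨_, Finset.mem_union_left _ (Finset.mem_image_of_mem _ hg), fun y hy b hb => ?_⟩
          rcases Finset.mem_insert.1 hy with rfl | hy
          · rw [hb] at hc'
            have : b ≠ c := fun h => hc' (by rw [h])
            rw [Function.update_self]
            revert this
            cases b <;> cases c <;> simp
          · rw [Function.update_of_ne (hne y hy)]
            exact hgh y hy b hb

/-- A set of at most `D` elements is the range of a list of length `D` padded with `none`. -/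
theorem card_le_pow_of_card_le {Y : Type*} [Fintype Y] (𝒮 : Finset (Finset Y)) (D : ℕ)
    (h : ∀ S ∈ 𝒮, S.card ≤ D) : 𝒮.card ≤ (Fintype.card Y + 1) ^ D := by
  classical
  let φ : (Fin D → Option Y) → Finset Y := fun u => Finset.univ.filter fun y => ∃ i, u i = some y
  have hsub : 𝒮 ⊆ Finset.univ.image φ := by
    intro S hS
    refine Finset.mem_image.2 ⟨fun i =>
      if hi : (i : ℕ) < S.card then some (S.equivFin.symm ⟨i, hi⟩ : Y) else none,
      Finset.mem_univ _, ?_⟩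
    ext y
    simp only [φ, Finset.mem_filter, Finset.mem_univ, true_and]
    constructor
    · rintro ⟨i, hi⟩
      split_ifs at hi with hlt
      rw [← Option.some.inj hi]
      exact Subtype.prop _
    · intro hy
      refine ⟨⟨S.equivFin ⟨y, hy⟩, (S.equivFin ⟨y, hy⟩).2.trans_le (h S hS)⟩, ?_⟩
      simp
  calc 𝒮.card ≤ (Finset.univ.image φ).card := Finset.card_le_card hsub
    _ ≤ Fintype.card (Fin D → Option Y) := Finset.card_image_le
    _ = (Fintype.card Y + 1) ^ D := by simp

/-! ### Level shattering and box covers. -/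

/-- Members of `G` realize all patterns of values `≥ t` and `≤ s` at the points `x i`. -/
def LevelShatters {Ω ι : Type*} (G : Set (Ω → ℝ)) (s t : ℝ) (x : ι → Ω) : Prop :=
  ∀ b : ι → Bool, ∃ g ∈ G, ∀ i, (b i = true → t ≤ g (x i)) ∧ (b i = false → g (x i) ≤ s)

theorem LevelShatters.injective {Ω ι : Type*} {G : Set (Ω → ℝ)} {s t : ℝ} {x : ι → Ω}
    (h : LevelShatters G s t x) (hst : s < t) : Function.Injective x := by
  classical
  intro i j hij
  by_contra hne
  obtain ⟨g, -, hg⟩ := h fun k => decide (k = i)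
  have h1 := (hg i).1 (by simp)
  have h2 := (hg j).2 (by simp [Ne.symm hne])
  rw [← hij] at h2
  linarith

theorem LevelShatters.comp {Ω ι κ : Type*} {G : Set (Ω → ℝ)} {s t : ℝ} {x : ι → Ω}
    (h : LevelShatters G s t x) (e : κ → ι) (he : Function.Injective e) :
    LevelShatters G s t (x ∘ e) := by
  intro b
  obtain ⟨g, hg, hgb⟩ := h (Function.extend e b fun _ => false)
  refine ⟨g, hg, fun i => ?_⟩
  have := hgb (e i)
  rwa [he.extend_apply] at this

theorem exists_level_disambiguation {Ω Y : Type*} [Fintype Y] (G : Set (Ω → ℝ)) (s t : ℝ)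
    (hst : s < t) (D : ℕ) (hD : ∀ x : Fin D → Ω, ¬ LevelShatters G s t x) (x : Y → Ω) (k : ℕ)
    (hk : (Fintype.card Y + 1) ^ D < 2 ^ k) :
    ∃ C : Finset (Y → Bool), C.card ≤ (Fintype.card Y + 1) ^ k ∧
      ∀ g ∈ G, ∃ c ∈ C, ∀ y, (c y = true → s < g (x y)) ∧ (c y = false → g (x y) < t) := by
  classical
  let lab : (Ω → ℝ) → Y → Option Bool := fun g y =>
    if t ≤ g (x y) then some true else if g (x y) ≤ s then some false else none
  obtain ⟨C, hC, hcov⟩ := exists_disambiguation Finset.univ k (lab '' G) (by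
    refine lt_of_le_of_lt (card_le_pow_of_card_le _ D fun S hS => ?_) hk
    by_contra! hlt
    have hsh : LevelShatters G s t (fun y : S => x y) := by
      intro b
      obtain ⟨_, ⟨g, hg, rfl⟩, hgb⟩ := mem_partialShatterer.1 hS
        fun y => if hy : y ∈ S then b ⟨y, hy⟩ else false
      refine ⟨g, hg, fun i => ?_⟩
      have h1 := hgb i i.2
      simp only [lab, Subtype.coe_eta, Finset.coe_mem, dite_true] at h1
      split_ifs at h1 with h2 h3
      · rw [← Option.some.inj h1]; simpa using h2
      · rw [← Option.some.inj h1]; simpa using h3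
    refine hD _ (hsh.comp (fun i : Fin D => S.equivFin.symm (Fin.castLE hlt.le i)) ?_)
    exact S.equivFin.symm.injective.comp (Fin.castLE_injective _))
  refine ⟨C, by simpa using hC, fun g hg => ?_⟩
  obtain ⟨c, hc, hcg⟩ := hcov _ ⟨g, hg, rfl⟩
  refine ⟨c, hc, fun y => ⟨fun h => ?_, fun h => ?_⟩⟩
  · by_contra! hle
    have := hcg y (Finset.mem_univ _) false (by
      simp only [lab]; rw [if_neg (by linarith), if_pos hle])
    simp [h] at this
  · by_contra! hle
    have := hcg y (Finset.mem_univ _) true (by simp only [lab]; rw [if_pos hle])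
    simp [h] at this

/-- Covering of the restrictions of a bounded class to finitely many points by boxes of
side `γ' + η`. -/
theorem exists_box_cover {Ω Y : Type*} [Fintype Y] (G : Set (Ω → ℝ)) (R γ' η : ℝ)
    (hG : ∀ g ∈ G, ∀ x, |g x| ≤ R) (hR : 0 ≤ R) (hγ' : 0 < γ') (hη : 0 < η) (D : ℕ)
    (hD : ∀ (s : ℝ) (x : Fin D → Ω), ¬ LevelShatters G s (s + γ') x) (x : Y → Ω) (k : ℕ)
    (hk : (Fintype.card Y + 1) ^ D < 2 ^ k) :
    ∃ C : Finset (Y → ℝ),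
      C.card ≤ ((Fintype.card Y + 1) ^ k) ^ (⌈2 * R / η⌉₊ + 1) ∧
      (∀ l ∈ C, ∀ y, |l y| ≤ R + η) ∧
      ∀ g ∈ G, ∃ l ∈ C, ∀ y, l y ≤ g (x y) ∧ g (x y) ≤ l y + (γ' + η) := by
  classical
  set K := ⌈2 * R / η⌉₊ with hK
  have hK1 : 2 * R ≤ K * η := by
    have := Nat.le_ceil (2 * R / η)
    rwa [div_le_iff₀ hη] at this
  have hK2 : K * η ≤ 2 * R + η := by
    have := (Nat.ceil_lt_add_one (a := 2 * R / η) (by positivity)).le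
    rw [← hK, ← sub_le_iff_le_add, le_div_iff₀ hη] at this
    linarith
  have hlev := fun j : Fin (K + 1) =>
    exists_level_disambiguation G (-R + j * η) (-R + j * η + γ') (by linarith) D (hD _) x k hk
  choose C hC hcov using hlev
  -- The disambiguations at different levels need not be monotone in the level; the highest level
  -- marked `true` suffices. The default value `0` is harmless because `-R` is a lower bound anyway.
  let J : (Fin (K + 1) → Y → Bool) → Y → ℕ := fun c y =>
    Nat.findGreatest (fun j => ∃ hj : j < K + 1, c ⟨j, hj⟩ y = true) K
  refine ⟨(Fintype.piFinset C).image fun c y => -R + J c y * η, ?_, ?_, fun g hg => ?_⟩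
  · refine Finset.card_image_le.trans ?_
    rw [Fintype.card_piFinset]
    calc _ ≤ ∏ _j : Fin (K + 1), (Fintype.card Y + 1) ^ k :=
          Finset.prod_le_prod' fun j _ => hC j
      _ = _ := by simp
  · intro l hl y
    obtain ⟨c, -, rfl⟩ := Finset.mem_image.1 hl
    have h1 : (J c y : ℝ) * η ≤ K * η := by
      gcongr
      exact Nat.findGreatest_le _
    have h2 : (0 : ℝ) ≤ J c y * η := by positivity
    rw [abs_le]
    constructor <;> linarith
  · choose c hc hcg using fun j => hcov j g hg
    refine ⟨_, Finset.mem_image_of_mem _ (Fintype.mem_piFinset.2 hc), fun y => ?_⟩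
    have hb := abs_le.1 (hG g hg (x y))
    constructor
    · rcases Nat.eq_zero_or_pos (J c y) with h0 | h0
      · simp [h0, hb.1]
      · obtain ⟨hj, hjt⟩ := Nat.findGreatest_of_ne_zero (P := fun j =>
          ∃ hj : j < K + 1, c ⟨j, hj⟩ y = true) (n := K) rfl h0.ne'
        exact ((hcg _ y).1 hjt).le
    · rcases (show J c y ≤ K from Nat.findGreatest_le K).eq_or_lt with h0 | h0
      -- At the top level the box starts at or above `R`, by `hK1`.
      · rw [h0]; linarith
      · have h1 := Nat.findGreatest_is_greatest (P := fun j =>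
          ∃ hj : j < K + 1, c ⟨j, hj⟩ y = true) (n := K) (k := J c y + 1) (Nat.lt_succ_self _) h0
        have h2 := (hcg ⟨J c y + 1, by omega⟩ y).2 (by
          by_contra hcon
          exact h1 ⟨by omega, by simpa using hcon⟩)
        push_cast at h2
        linarith

/-! ### Random signs on a fixed double sample. -/

/-- The sign `±1` encoded by a Boolean. -/
def boolSign (b : Bool) : ℝ := if b then 1 else -1

theorem sum_exp_signed_sum_le {ι : Type*} [Fintype ι] [DecidableEq ι] (a : ι → ℝ) (M t : ℝ)
    (ha : ∀ i, |a i| ≤ M) :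
    ∑ σ : ι → Bool, Real.exp (t * ∑ i, boolSign (σ i) * a i) ≤
      2 ^ Fintype.card ι * Real.exp (Fintype.card ι * (t ^ 2 * M ^ 2 / 2)) := by
  have h1 : ∑ σ : ι → Bool, Real.exp (t * ∑ i, boolSign (σ i) * a i) =
      ∏ i, ∑ b : Bool, Real.exp (t * (boolSign b * a i)) := by
    rw [Finset.prod_univ_sum, Fintype.piFinset_univ]
    refine Finset.sum_congr rfl fun σ _ => ?_
    rw [Finset.mul_sum, Real.exp_sum]
  have h2 : ∀ i, ∑ b : Bool, Real.exp (t * (boolSign b * a i)) ≤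
      2 * Real.exp (t ^ 2 * M ^ 2 / 2) := by
    intro i
    have hc : ∑ b : Bool, Real.exp (t * (boolSign b * a i)) = 2 * Real.cosh (t * a i) := by
      rw [Real.cosh_eq]
      simp [boolSign]
      ring
    rw [hc]
    refine mul_le_mul_of_nonneg_left ((Real.cosh_le_exp_half_sq _).trans ?_) (by norm_num)
    rw [mul_pow]
    have : a i ^ 2 ≤ M ^ 2 := sq_le_sq.2 ((ha i).trans (le_abs_self M))
    gcongr
  rw [h1]
  refine (Finset.prod_le_prod (fun i _ => Finset.sum_nonneg fun b _ => (Real.exp_pos _).le)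
    fun i _ => h2 i).trans (le_of_eq ?_)
  rw [Finset.prod_const, Finset.card_univ, mul_pow, ← Real.exp_nat_mul]

/-- Hoeffding's inequality for sums with uniformly random signs, in counting form. -/
theorem card_signed_sum_gt_le {ι : Type*} [Fintype ι] [DecidableEq ι] (a : ι → ℝ) (M τ : ℝ)
    (hM : 0 < M) (hτ : 0 < τ) (ha : ∀ i, |a i| ≤ M) :
    ((Finset.univ.filter fun σ : ι → Bool =>
      Fintype.card ι * τ < ∑ i, boolSign (σ i) * a i).card : ℝ) ≤
      2 ^ Fintype.card ι * Real.exp (-(Fintype.card ι * (τ ^ 2 / (2 * M ^ 2)))) := by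
  classical
  set N : ℝ := (Fintype.card ι : ℝ)
  -- This minimizes the Chernoff exponent `t ^ 2 * M ^ 2 / 2 - t * τ`.
  set t := τ / M ^ 2 with ht
  have ht0 : 0 < t := by positivity
  set A := Finset.univ.filter fun σ : ι → Bool => N * τ < ∑ i, boolSign (σ i) * a i
  have h1 : A.card * Real.exp (t * (N * τ)) ≤
      ∑ σ : ι → Bool, Real.exp (t * ∑ i, boolSign (σ i) * a i) := by
    calc A.card * Real.exp (t * (N * τ)) = ∑ σ ∈ A, Real.exp (t * (N * τ)) := by simp
      _ ≤ ∑ σ ∈ A, Real.exp (t * ∑ i, boolSign (σ i) * a i) := by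
          refine Finset.sum_le_sum fun σ hσ => ?_
          have := (Finset.mem_filter.1 hσ).2
          gcongr
      _ ≤ _ := Finset.sum_le_univ_sum_of_nonneg fun σ => (Real.exp_pos _).le
  have h2 := h1.trans (sum_exp_signed_sum_le a M t ha)
  rw [← le_div_iff₀ (Real.exp_pos _), mul_div_assoc, ← Real.exp_sub] at h2
  refine h2.trans (le_of_eq ?_)
  congr 2
  rw [ht]
  field_simp
  ring

/-- For a class without large level-shattered families, few sign patterns make the
symmetrized deviation on a fixed double sample large. -/
theorem card_signed_deviation_le {Ω : Type*} (G : Set (Ω → ℝ)) (R γ' η τ : ℝ)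
    (hG : ∀ g ∈ G, ∀ x, |g x| ≤ R) (hR : 0 ≤ R) (hγ' : 0 < γ') (hη : 0 < η) (hτ : 0 < τ) (D : ℕ)
    (hD : ∀ (s : ℝ) (x : Fin D → Ω), ¬ LevelShatters G s (s + γ') x) (n : ℕ)
    (z : Fin n ⊕ Fin n → Ω) (k : ℕ) (hk : (2 * n + 1) ^ D < 2 ^ k)
    (A : Finset (Fin n → Bool))
    (hA : ∀ σ ∈ A, ∃ g ∈ G, n * (γ' + η + τ) <
      |∑ i, boolSign (σ i) * (g (z (.inl i)) - g (z (.inr i)))|) :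
    (A.card : ℝ) ≤ ((2 * n + 1) ^ k) ^ (⌈2 * R / η⌉₊ + 1) *
      (2 * (2 ^ n * Real.exp (-(n * (τ ^ 2 / (2 * (2 * (R + η)) ^ 2)))))) := by
  classical
  have hcard : Fintype.card (Fin n ⊕ Fin n) = 2 * n := by simp; ring
  obtain ⟨C, hC, hCb, hcov⟩ := exists_box_cover G R γ' η hG hR hγ' hη D hD z k (by rwa [hcard])
  rw [hcard] at hC
  let T : (Fin n ⊕ Fin n → ℝ) → ℝ → Finset (Fin n → Bool) := fun l r =>
    Finset.univ.filter fun σ : Fin n → Bool =>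
      Fintype.card (Fin n) * τ < ∑ i, boolSign (σ i) * (r * (l (.inl i) - l (.inr i)))
  have hT : ∀ l ∈ C, ∀ r : ℝ, |r| = 1 → ((T l r).card : ℝ) ≤
      2 ^ n * Real.exp (-(n * (τ ^ 2 / (2 * (2 * (R + η)) ^ 2)))) := by
    intro l hl r hr
    have := card_signed_sum_gt_le (fun i : Fin n => r * (l (.inl i) - l (.inr i)))
      (2 * (R + η)) τ (by positivity) hτ (fun i => by
        rw [abs_mul, hr, one_mul]
        have h1 := abs_le.1 (hCb l hl (.inl i))
        have h2 := abs_le.1 (hCb l hl (.inr i))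
        rw [abs_le]
        constructor <;> linarith)
    simpa only [T, Fintype.card_fin] using this
  have hsub : A ⊆ C.biUnion fun l => T l 1 ∪ T l (-1) := by
    intro σ hσ
    obtain ⟨g, hg, hdev⟩ := hA σ hσ
    obtain ⟨l, hl, hlg⟩ := hcov g hg
    refine Finset.mem_biUnion.2 ⟨l, hl, ?_⟩
    -- Both `g - l` values of a pair lie in `[0, γ' + η]`, so their difference is at most `γ' + η`
    -- in absolute value.
    have key : ∀ r : ℝ, |r| = 1 → ∑ i, r * (boolSign (σ i) * (g (z (.inl i)) - g (z (.inr i)))) ≤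
        ∑ i, boolSign (σ i) * (r * (l (.inl i) - l (.inr i))) + n * (γ' + η) := by
      intro r hr
      have : (n : ℝ) * (γ' + η) = ∑ _i : Fin n, (γ' + η) := by
        rw [Finset.sum_const, Finset.card_univ, Fintype.card_fin, nsmul_eq_mul]
      rw [this, ← Finset.sum_add_distrib]
      refine Finset.sum_le_sum fun i _ => ?_
      have h1 := hlg (.inl i)
      have h2 := hlg (.inr i)
      rcases eq_or_eq_neg_of_abs_eq hr with rfl | rfl <;> cases σ i <;> simp [boolSign] <;> linarith
    rcases lt_abs.1 hdev with h | h
    · refine Finset.mem_union_left _ (Finset.mem_filter.2 ⟨Finset.mem_univ _, ?_⟩)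
      have := key 1 (by simp)
      simp only [one_mul] at this ⊢
      rw [Fintype.card_fin]
      linarith
    · refine Finset.mem_union_right _ (Finset.mem_filter.2 ⟨Finset.mem_univ _, ?_⟩)
      have := key (-1) (by simp)
      rw [← Finset.mul_sum] at this
      rw [Fintype.card_fin]
      linarith
  calc (A.card : ℝ) ≤ ((C.biUnion fun l => T l 1 ∪ T l (-1)).card : ℝ) := by
        exact_mod_cast Finset.card_le_card hsub
    _ ≤ ∑ l ∈ C, ((T l 1 ∪ T l (-1)).card : ℝ) := by exact_mod_cast Finset.card_biUnion_le
    _ ≤ ∑ l ∈ C, (2 * (2 ^ n * Real.exp (-(n * (τ ^ 2 / (2 * (2 * (R + η)) ^ 2)))))) := by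
        refine Finset.sum_le_sum fun l hl => ?_
        have h1 := hT l hl 1 (by simp)
        have h2 := hT l hl (-1) (by simp)
        have h3 : ((T l 1 ∪ T l (-1)).card : ℝ) ≤ (T l 1).card + (T l (-1)).card := by
          exact_mod_cast Finset.card_union_le _ _
        linarith
    _ = C.card * (2 * (2 ^ n * Real.exp (-(n * (τ ^ 2 / (2 * (2 * (R + η)) ^ 2)))))) := by simp
    _ ≤ _ := by
        gcongr
        exact_mod_cast hC

/-! ### Duality. -/

/-- A level-shattered family in the dual class yields one in the primal class. -/
theorem LevelShatters.of_dualClass {X : Type*} {F : Set (X → ℝ)} {s t : ℝ} {d : ℕ}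
    {f : (Fin d → Bool) → F} (h : LevelShatters (dualClass F) s t f) :
    ∃ x : Fin d → X, LevelShatters F s t x := by
  -- The `j`-th point realizes the pattern that reads off the `j`-th bit of the index.
  choose φ hφ hφf using fun j : Fin d => h fun u => u j
  choose x hx using hφ
  refine ⟨x, fun b => ⟨f b, (f b).2, fun j => ?_⟩⟩
  have := hφf j b
  rwa [hx j] at this

/-! ### Finitely supported distributions and necessity of finite dimension. -/

theorem aemeasurable_of_finite_ae {α β : Type*} [MeasurableSpace α] [MeasurableSingletonClass α]
    [MeasurableSpace β] [Nonempty β] {μ : Measure α} {D : Set α} (hD : D.Finite)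
    (hμ : ∀ᵐ x ∂μ, x ∈ D) (f : α → β) : AEMeasurable f μ := by
  classical
  obtain ⟨b⟩ := ‹Nonempty β›
  refine ⟨D.piecewise f fun _ => b, ?_, ?_⟩
  · refine measurable_of_measurable_on_compl_finite D hD ?_
    have : (Dᶜ.domRestrict (D.piecewise f fun _ => b)) = fun _ => b := by
      ext x
      exact Set.piecewise_eq_of_notMem _ _ _ x.2
    rw [this]
    exact measurable_const
  · filter_upwards [hμ] with x hx
    simp [hx]

theorem ae_pi_forall_mem {Ω ι : Type*} [Fintype ι] [MeasurableSpace Ω] {q : Measure Ω}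
    [IsProbabilityMeasure q] {D : Set Ω} (hq : ∀ᵐ x ∂q, x ∈ D) :
    ∀ᵐ S ∂(Measure.pi fun _ : ι => q), ∀ i, S i ∈ D :=
  ae_all_iff.2 fun i =>
    (measurePreserving_eval (fun _ : ι => q) i).quasiMeasurePreserving.ae hq

theorem isMeasurableClass_of_finite_ae {Ω : Type*} [MeasurableSpace Ω]
    [MeasurableSingletonClass Ω] {q : Measure Ω} [IsProbabilityMeasure q] {D : Set Ω}
    (hD : D.Finite) (hq : ∀ᵐ x ∂q, x ∈ D) (G : Set (Ω → ℝ)) : IsMeasurableClass q G where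
  aemeasurable g _ := aemeasurable_of_finite_ae hD hq g
  aemeasurable_iSup n a := by
    refine aemeasurable_of_finite_ae (D := {S | ∀ i, S i ∈ D})
      (Set.Finite.pi' fun _ => hD) (ae_pi_forall_mem hq) _

/-- The uniform distribution on a finite family of points. -/
noncomputable def uniformMeasure {Ω ι : Type*} [Fintype ι] [MeasurableSpace Ω] (x : ι → Ω) :
    Measure Ω :=
  (Fintype.card ι : ℝ≥0∞)⁻¹ • ∑ j, Measure.dirac (x j)

theorem isProbabilityMeasure_uniformMeasure {Ω ι : Type*} [Fintype ι] [Nonempty ι]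
    [MeasurableSpace Ω] (x : ι → Ω) : IsProbabilityMeasure (uniformMeasure x) where
  measure_univ := by
    simp only [uniformMeasure, Measure.smul_apply, Measure.finsetSum_apply, measure_univ,
      Finset.sum_const, Finset.card_univ, smul_eq_mul, nsmul_eq_mul, mul_one]
    exact ENNReal.inv_mul_cancel (by simp) (by simp)

theorem ae_uniformMeasure_mem_range {Ω ι : Type*} [Fintype ι] [MeasurableSpace Ω]
    [MeasurableSingletonClass Ω] (x : ι → Ω) : ∀ᵐ y ∂uniformMeasure x, y ∈ Set.range x := by
  refine Measure.ae_smul_measure ?_ _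
  rw [ae_iff, Measure.finsetSum_apply]
  refine Finset.sum_eq_zero fun j _ => ?_
  simp

theorem integral_uniformMeasure {Ω ι : Type*} [Fintype ι] [MeasurableSpace Ω]
    [MeasurableSingletonClass Ω] (x : ι → Ω) (f : Ω → ℝ) :
    ∫ y, f y ∂uniformMeasure x = (Fintype.card ι : ℝ)⁻¹ * ∑ j, f (x j) := by
  rw [uniformMeasure, integral_smul_measure, integral_finsetSum_measure]
  · simp
  · exact fun j _ => integrable_dirac (by simp)

/-- Choose a member that is low exactly on the sampled points. A sample of size `n` meets at most a
fraction `1 / c` of the `n * c` distinct points, and each of these lowers the sum by at most `2 *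
R`. -/
theorem LevelShatters.exists_deviation {Ω : Type*} {F : Set (Ω → ℝ)} {R s γ' : ℝ} {n c : ℕ}
    (hF : ∀ f ∈ F, ∀ x, |f x| ≤ R) (hn : 0 < n) (hc : 0 < c) {x : Fin (n * c) → Ω}
    (hx : LevelShatters F s (s + γ') x) (hγ' : 0 < γ') (S : Fin n → Ω)
    (hS : ∀ i, S i ∈ Set.range x) :
    ∃ f ∈ F, γ' - 2 * R / c ≤
      ((n * c : ℕ) : ℝ)⁻¹ * ∑ j, f (x j) - (1 / (n : ℝ)) * ∑ i, f (S i) := by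
  classical
  have hinj := hx.injective (by linarith)
  have hn' : (0 : ℝ) < n := by exact_mod_cast hn
  have hc' : (0 : ℝ) < c := by exact_mod_cast hc
  let j₀ : Fin (n * c) := ⟨0, Nat.mul_pos hn hc⟩
  have hs1 : s + γ' ≤ R := by
    obtain ⟨f, hf, hfb⟩ := hx fun _ => true
    exact ((hfb j₀).1 rfl).trans (abs_le.1 (hF f hf _)).2
  obtain ⟨f, hf, hfb⟩ := hx fun j => decide (x j ∉ Set.range S)
  refine ⟨f, hf, ?_⟩
  have h1 : ∑ i, f (S i) ≤ n * s := by
    calc ∑ i, f (S i) ≤ ∑ _i : Fin n, s := Finset.sum_le_sum fun i _ => by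
          obtain ⟨j, hj⟩ := hS i
          rw [← hj]
          exact (hfb j).2 (by simp [hj])
      _ = n * s := by simp
  set B := Finset.univ.filter fun j => x j ∈ Set.range S with hB
  have hBn : B.card ≤ n := by
    calc B.card = (B.image x).card := (Finset.card_image_of_injective _ hinj).symm
      _ ≤ (Finset.univ.image S).card := by
          refine Finset.card_le_card fun y hy => ?_
          obtain ⟨j, hj, rfl⟩ := Finset.mem_image.1 hy
          simpa [hB] using hj
      _ ≤ n := Finset.card_image_le.trans (by simp)
  have hR : 0 ≤ R := (abs_nonneg _).trans (hF f hf (x j₀))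
  have h2 : (n * c : ℕ) * (s + γ') - n * (2 * R) ≤ ∑ j, f (x j) := by
    calc (n * c : ℕ) * (s + γ') - n * (2 * R)
        ≤ (n * c : ℕ) * (s + γ') - B.card * (2 * R) := by gcongr
      _ = ∑ j, ((s + γ') - if j ∈ B then 2 * R else 0) := by
          rw [Finset.sum_sub_distrib, Finset.sum_ite_mem]
          simp [mul_add]
      _ ≤ ∑ j, f (x j) := Finset.sum_le_sum fun j _ => by
          by_cases hj : j ∈ B
          · rw [if_pos hj]
            have := (abs_le.1 (hF f hf (x j))).1
            linarith
          · rw [if_neg hj, sub_zero]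
            refine (hfb j).1 ?_
            simpa [hB] using hj
  have h3 : (s + γ') - 2 * R / c ≤ ((n * c : ℕ) : ℝ)⁻¹ * ∑ j, f (x j) := by
    have : (s + γ') - 2 * R / c =
        ((n * c : ℕ) : ℝ)⁻¹ * ((n * c : ℕ) * (s + γ') - n * (2 * R)) := by
      push_cast
      field_simp
    rw [this]
    gcongr
  have h4 : (1 / (n : ℝ)) * ∑ i, f (S i) ≤ s := by
    calc (1 / (n : ℝ)) * ∑ i, f (S i) ≤ (1 / (n : ℝ)) * (n * s) := by gcongr
      _ = s := by field_simp
  linarith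

/-- Uniform convergence at accuracy `γ` bounds the size of families shattered with a larger
gap. -/
theorem UniformConvergence.exists_not_levelShatters {Ω : Type*} (𝒜 : MeasurableSpace Ω)
    [MeasurableSingletonClass Ω] {F : Set (Ω → ℝ)} {R γ γ' : ℝ}
    (hF : ∀ f ∈ F, ∀ x, |f x| ≤ R) (hγ : 0 < γ) (hγ' : γ < γ') (hUC : UniformConvergence 𝒜 F γ) :
    ∃ d : ℕ, ∀ (s : ℝ) (x : Fin d → Ω), ¬ LevelShatters F s (s + γ') x := by
  obtain ⟨m, hm⟩ := hUC ((γ' - γ) / 2) (by linarith) (1 / 2) (by norm_num)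
  -- Large enough that the loss `2 * R / c` is below half of `γ' - γ`; the other half is the
  -- accuracy `ε`.
  obtain ⟨c, hc⟩ := exists_nat_gt (max (2 * R / ((γ' - γ) / 2)) 0)
  have hc0 : (0 : ℝ) < c := (le_max_right _ _).trans_lt hc
  have hc0' : 0 < c := by exact_mod_cast hc0
  have hcR : 2 * R / c < (γ' - γ) / 2 := by
    have := (le_max_left _ _).trans_lt hc
    rw [div_lt_iff₀ (by linarith)] at this
    rw [div_lt_iff₀ hc0]
    linarith
  refine ⟨(m + 1) * c, fun s x hx => ?_⟩
  have : Nonempty (Fin ((m + 1) * c)) := ⟨⟨0, Nat.mul_pos m.succ_pos hc0'⟩⟩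
  have := isProbabilityMeasure_uniformMeasure x
  have hae := ae_uniformMeasure_mem_range x
  have h := hm (uniformMeasure x) inferInstance
    (isMeasurableClass_of_finite_ae (Set.finite_range x) hae F) (m + 1) (Nat.le_succ m)
  have h1 : (Measure.pi fun _ : Fin (m + 1) => uniformMeasure x)
      {S | ENNReal.ofReal (γ + (γ' - γ) / 2) < supDeviation (uniformMeasure x) F S} = 1 := by
    refine le_antisymm prob_le_one ?_
    rw [← measure_univ (μ := Measure.pi fun _ : Fin (m + 1) => uniformMeasure x)]
    refine measure_mono_ae ?_
    filter_upwards [ae_pi_forall_mem (ι := Fin (m + 1)) hae] with S hS _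
    obtain ⟨f, hf, hdev⟩ := hx.exists_deviation hF m.succ_pos hc0' (hγ.trans hγ') S hS
    refine lt_of_lt_of_le ?_ (le_iSup₂ f hf)
    rw [ENNReal.ofReal_lt_ofReal_iff_of_nonneg (by linarith), integral_uniformMeasure,
      Fintype.card_fin]
    refine lt_of_lt_of_le ?_ (hdev.trans (le_abs_self _))
    linarith
  rw [h1] at h
  have h2 : ENNReal.ofReal (1 / 2) < 1 := by
    rw [← ENNReal.ofReal_one]
    exact (ENNReal.ofReal_lt_ofReal_iff one_pos).2 (by norm_num)
  exact absurd h (not_le.2 h2)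

/-! ### Symmetrization. -/

theorem IsMeasurableClass.aemeasurable_iSup_fintype {Ω ι : Type*} [Fintype ι]
    [MeasurableSpace Ω] {q : Measure Ω} [IsProbabilityMeasure q] {G : Set (Ω → ℝ)}
    (h : IsMeasurableClass q G) (a : ι → ℝ) :
    AEMeasurable (fun x : ι → Ω => ⨆ g ∈ G, ENNReal.ofReal |∑ i, a i * g (x i)|)
      (Measure.pi fun _ : ι => q) := by
  let e := Fintype.equivFin ι
  have h1 := (h.aemeasurable_iSup _ (a ∘ e.symm)).comp_quasiMeasurePreserving
    (measurePreserving_piCongrLeft (fun _ : Fin (Fintype.card ι) => q) e).quasiMeasurePreserving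
  convert h1 using 1
  funext x
  simp only [Function.comp_apply]
  refine iSup_congr fun g => iSup_congr fun _ => ?_
  congr 2
  rw [← e.sum_comp]
  refine Finset.sum_congr rfl fun i _ => ?_
  rw [e.symm_apply_apply]
  congr 2
  exact (Equiv.piCongrLeft_apply_apply (fun _ : Fin (Fintype.card ι) => Ω) e x i).symm

/-- The double samples on which the deviation between the two halves, symmetrized with the
signs `σ`, exceeds `θ` for some member of the class. -/
def signedDeviationSet {Ω : Type*} (G : Set (Ω → ℝ)) (θ : ℝ) {n : ℕ} (σ : Fin n → Bool) :
    Set (Fin n ⊕ Fin n → Ω) :=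
  {z | ENNReal.ofReal θ <
    ⨆ g ∈ G, ENNReal.ofReal |∑ i, boolSign (σ i) * (g (z (.inl i)) - g (z (.inr i)))|}

theorem mem_signedDeviationSet {Ω : Type*} {G : Set (Ω → ℝ)} {θ : ℝ} (hθ : 0 ≤ θ) {n : ℕ}
    {σ : Fin n → Bool} {z : Fin n ⊕ Fin n → Ω} : z ∈ signedDeviationSet G θ σ ↔
      ∃ g ∈ G, θ < |∑ i, boolSign (σ i) * (g (z (.inl i)) - g (z (.inr i)))| := by
  simp only [signedDeviationSet, Set.mem_ofPred_eq, lt_iSup_iff, exists_prop,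
    ENNReal.ofReal_lt_ofReal_iff_of_nonneg hθ]

theorem nullMeasurableSet_signedDeviationSet {Ω : Type*} [MeasurableSpace Ω] {q : Measure Ω}
    [IsProbabilityMeasure q] {G : Set (Ω → ℝ)} (h : IsMeasurableClass q G) (θ : ℝ) {n : ℕ}
    (σ : Fin n → Bool) :
    NullMeasurableSet (signedDeviationSet G θ σ) (Measure.pi fun _ : Fin n ⊕ Fin n => q) := by
  have h1 := h.aemeasurable_iSup_fintype
    (Sum.elim (fun i => boolSign (σ i)) fun i => -boolSign (σ i))
  simp only [Fintype.sum_sum_type, Sum.elim_inl, Sum.elim_inr, ← Finset.sum_add_distrib, neg_mul,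
    ← sub_eq_add_neg, ← mul_sub] at h1
  exact nullMeasurableSet_lt aemeasurable_const h1

/-- Exchange of the entries of a double sample at the indices with sign `-1`. -/
def signSwap {n : ℕ} (σ : Fin n → Bool) : Equiv.Perm (Fin n ⊕ Fin n) :=
  Function.Involutive.toPerm
    (fun j => match j with
      | .inl i => if σ i then .inl i else .inr i
      | .inr i => if σ i then .inr i else .inl i)
    (by
      rintro (i | i) <;> cases h : σ i <;> simp [h])

/-- Exchanging the two entries of a pair flips its sign and preserves the product measure. -/
theorem measure_signedDeviationSet {Ω : Type*} [MeasurableSpace Ω] (q : Measure Ω)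
    [IsProbabilityMeasure q] (G : Set (Ω → ℝ)) (θ : ℝ) {n : ℕ} (σ : Fin n → Bool) :
    (Measure.pi fun _ : Fin n ⊕ Fin n => q) (signedDeviationSet G θ σ) =
      (Measure.pi fun _ : Fin n ⊕ Fin n => q) (signedDeviationSet G θ fun _ => true) := by
  have h := measurePreserving_piCongrLeft (fun _ : Fin n ⊕ Fin n => q) (signSwap σ)
  rw [← h.measure_preimage_equiv (signedDeviationSet G θ fun _ => true)]
  congr 1
  ext z
  simp only [signedDeviationSet, Set.mem_ofPred_eq, Set.mem_preimage]
  have hz : ∀ j, (MeasurableEquiv.piCongrLeft (fun _ : Fin n ⊕ Fin n => Ω) (signSwap σ)) z j =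
      z (signSwap σ j) := by
    intro j
    have := Equiv.piCongrLeft_apply_apply (fun _ : Fin n ⊕ Fin n => Ω) (signSwap σ) z
      (signSwap σ j)
    rwa [show signSwap σ (signSwap σ j) = j from (signSwap σ).left_inv j] at this
  simp only [hz]
  have hs : ∀ (g : Ω → ℝ) (i : Fin n),
      boolSign (σ i) * (g (z (.inl i)) - g (z (.inr i))) =
      boolSign true * (g (z (signSwap σ (.inl i))) - g (z (signSwap σ (.inr i)))) := by
    intro g i
    have hl : signSwap σ (.inl i) = if σ i then .inl i else .inr i := rfl
    have hr : signSwap σ (.inr i) = if σ i then .inr i else .inl i := rfl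
    rw [hl, hr]
    cases σ i <;> simp [boolSign]
  simp_rw [hs]

/-- Averaging over all signs and exchanging sum and integral reduces the bound to counting bad signs
for each fixed double sample. The exchange uses the measurability supplied by admissibility. -/
theorem measure_signedDeviationSet_le {Ω : Type*} [MeasurableSpace Ω] {q : Measure Ω}
    [IsProbabilityMeasure q] {G : Set (Ω → ℝ)} (h : IsMeasurableClass q G) {θ : ℝ} (hθ : 0 ≤ θ)
    {n : ℕ} (b : ℝ)
    (hb : ∀ (z : Fin n ⊕ Fin n → Ω) (A : Finset (Fin n → Bool)),
      (∀ σ ∈ A, ∃ g ∈ G, θ < |∑ i, boolSign (σ i) * (g (z (.inl i)) - g (z (.inr i)))|) →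
      (A.card : ℝ) ≤ 2 ^ n * b) :
    (Measure.pi fun _ : Fin n ⊕ Fin n => q) (signedDeviationSet G θ fun _ => true) ≤
      ENNReal.ofReal b := by
  classical
  set μ := Measure.pi fun _ : Fin n ⊕ Fin n => q
  have h1 : (2 : ℝ≥0∞) ^ n * μ (signedDeviationSet G θ fun _ => true) =
      ∑ σ : Fin n → Bool, μ (signedDeviationSet G θ σ) := by
    simp [μ, measure_signedDeviationSet q G θ]
  have h2 : ∑ σ : Fin n → Bool, μ (signedDeviationSet G θ σ) =
      ∫⁻ z, ∑ σ : Fin n → Bool, (signedDeviationSet G θ σ).indicator (fun _ => 1) z ∂μ := by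
    have hn := fun σ : Fin n → Bool => nullMeasurableSet_signedDeviationSet h θ σ
    rw [lintegral_finsetSum' _ fun σ _ => aemeasurable_const.indicator₀ (hn σ)]
    exact Finset.sum_congr rfl fun σ _ => (lintegral_indicator_one₀ (hn σ)).symm
  have h3 : ∀ z, ∑ σ : Fin n → Bool, (signedDeviationSet G θ σ).indicator (fun _ => (1 : ℝ≥0∞)) z ≤
      ENNReal.ofReal (2 ^ n * b) := by
    intro z
    have hA := hb z (Finset.univ.filter fun σ => z ∈ signedDeviationSet G θ σ) fun σ hσ =>
      (mem_signedDeviationSet hθ).1 (Finset.mem_filter.1 hσ).2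
    calc _ = ((Finset.univ.filter fun σ => z ∈ signedDeviationSet G θ σ).card : ℝ≥0∞) := by
          simp [Set.indicator_apply]
      _ ≤ _ := by
          rw [← ENNReal.ofReal_natCast]
          exact ENNReal.ofReal_le_ofReal hA
  have h4 : (2 : ℝ≥0∞) ^ n * μ (signedDeviationSet G θ fun _ => true) ≤
      2 ^ n * ENNReal.ofReal b := by
    rw [h1, h2]
    refine (lintegral_mono h3).trans (le_of_eq ?_)
    rw [lintegral_const, measure_univ, mul_one, ENNReal.ofReal_mul (by positivity)]
    simp [ENNReal.ofReal_pow]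
  exact (ENNReal.mul_le_mul_iff_right (by simp) (by simp)).1 h4

/-- Chebyshev's inequality for a single function, applied to the ghost sample. -/
theorem measure_pi_average_deviation_le {Ω : Type*} [MeasurableSpace Ω] (q : Measure Ω)
    [IsProbabilityMeasure q] {g : Ω → ℝ} (hg : AEMeasurable g q) {R : ℝ} (hR : ∀ x, |g x| ≤ R)
    {n : ℕ} (hn : 0 < n) {τ : ℝ} (hτ : 0 < τ) :
    (Measure.pi fun _ : Fin n => q) {S | n * τ ≤ |∑ i, g (S i) - n * ∫ x, g x ∂q|} ≤
      ENNReal.ofReal (R ^ 2 / (n * τ ^ 2)) := by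
  have hn' : (0 : ℝ) < n := by exact_mod_cast hn
  have hL : MemLp g 2 q := MemLp.of_bound hg.aestronglyMeasurable R (.of_forall hR)
  have hLi : ∀ i : Fin n, MemLp (fun S : Fin n → Ω => g (S i)) 2 (Measure.pi fun _ => q) :=
    fun i => hL.comp_measurePreserving (measurePreserving_eval (fun _ : Fin n => q) i)
  have hv := ProbabilityTheory.variance_sum_pi (μ := fun _ : Fin n => q) (X := fun _ => g)
    fun _ => hL
  have hgv : ProbabilityTheory.variance g q ≤ R ^ 2 := by
    refine (ProbabilityTheory.variance_le_sq_of_bounded (a := -R) (b := R)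
      (.of_forall fun x => abs_le.1 (hR x)) hg).trans (le_of_eq ?_)
    ring
  have hLs : MemLp (∑ i, fun S : Fin n → Ω => g (S i)) 2 (Measure.pi fun _ => q) :=
    memLp_finsetSum' _ fun i _ => hLi i
  have hint : ∫ S, (∑ i, fun S : Fin n → Ω => g (S i)) S ∂(Measure.pi fun _ : Fin n => q) =
      n * ∫ x, g x ∂q := by
    simp only [Finset.sum_apply]
    rw [integral_finsetSum _ fun i _ => (hLi i).integrable one_le_two]
    have : ∀ i : Fin n, ∫ S : Fin n → Ω, g (S i) ∂(Measure.pi fun _ => q) = ∫ x, g x ∂q :=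
      fun i => integral_comp_eval (μ := fun _ : Fin n => q) hg.aestronglyMeasurable
    simp [this]
  have h := ProbabilityTheory.meas_ge_le_variance_div_sq hLs (c := n * τ) (by positivity)
  rw [hint, hv] at h
  simp only [Finset.sum_apply] at h
  refine h.trans (ENNReal.ofReal_le_ofReal ?_)
  rw [Finset.sum_const, Finset.card_univ, Fintype.card_fin, nsmul_eq_mul,
    div_le_div_iff₀ (by positivity) (by positivity)]
  calc n * ProbabilityTheory.variance g q * (n * τ ^ 2) ≤ n * R ^ 2 * (n * τ ^ 2) := by gcongr
    _ = R ^ 2 * (n * τ) ^ 2 := by ring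

/-- Symmetrization with a ghost sample, for outer probabilities. -/
theorem measure_supDeviation_le {Ω : Type*} [MeasurableSpace Ω] {q : Measure Ω}
    [IsProbabilityMeasure q] {G : Set (Ω → ℝ)} (h : IsMeasurableClass q G) {R : ℝ}
    (hG : ∀ g ∈ G, ∀ x, |g x| ≤ R) {n : ℕ} (hn : 0 < n) {α τ : ℝ} (hα : 0 ≤ α) (hτ : 0 < τ)
    (hnR : R ^ 2 / (n * τ ^ 2) ≤ 1 / 2) :
    (Measure.pi fun _ : Fin n => q) {S | ENNReal.ofReal (α + τ) < supDeviation q G S} ≤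
      2 * (Measure.pi fun _ : Fin n ⊕ Fin n => q)
        (signedDeviationSet G (n * α) fun _ : Fin n => true) := by
  have hn' : (0 : ℝ) < n := by exact_mod_cast hn
  set ν := Measure.pi fun _ : Fin n => q
  set μ := Measure.pi fun _ : Fin n ⊕ Fin n => q
  set B := signedDeviationSet G (n * α) fun _ : Fin n => true
  set e := MeasurableEquiv.sumPiEquivProdPi fun _ : Fin n ⊕ Fin n => Ω
  have he : MeasurePreserving e.symm (ν.prod ν) μ :=
    measurePreserving_sumPiEquivProdPi_symm fun _ : Fin n ⊕ Fin n => q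
  -- The measurable hull permits Fubini and Markov; the set of bad samples itself need not be
  -- measurable.
  set B' := e.symm ⁻¹' toMeasurable μ B with hB'
  have hB'm : MeasurableSet B' := e.symm.measurable (measurableSet_toMeasurable μ B)
  have h1 : ∫⁻ S, ν (Prod.mk S ⁻¹' B') ∂ν = μ B := by
    rw [← Measure.prod_apply hB'm, hB', he.measure_preimage_equiv, measure_toMeasurable]
  have h2 : {S | ENNReal.ofReal (α + τ) < supDeviation q G S} ⊆
      {S | 2⁻¹ ≤ ν (Prod.mk S ⁻¹' B')} := by
    intro S hS
    simp only [supDeviation, Set.mem_ofPred_eq, lt_iSup_iff, exists_prop] at hS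
    obtain ⟨g, hg, hdev⟩ := hS
    rw [ENNReal.ofReal_lt_ofReal_iff_of_nonneg (by positivity)] at hdev
    set U := {S' : Fin n → Ω | n * τ ≤ |∑ i, g (S' i) - n * ∫ x, g x ∂q|} with hU
    have hUle : ν U ≤ 2⁻¹ := by
      refine (measure_pi_average_deviation_le q (h.aemeasurable g hg) (hG g hg) hn hτ).trans ?_
      refine (ENNReal.ofReal_le_ofReal hnR).trans (le_of_eq ?_)
      rw [one_div, ENNReal.ofReal_inv_of_pos two_pos]
      simp
    -- If `g` is far from its mean on `S` and close to it on `S'`, the two halves are far apart.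
    have hsub : Uᶜ ⊆ Prod.mk S ⁻¹' B' := by
      intro S' hS'
      refine subset_toMeasurable μ B ?_
      refine (mem_signedDeviationSet (by positivity)).2 ⟨g, hg, ?_⟩
      have hl : ∀ i, e.symm (S, S') (.inl i) = S i := fun i => rfl
      have hr : ∀ i, e.symm (S, S') (.inr i) = S' i := fun i => rfl
      simp only [hl, hr, boolSign, if_true, one_mul, Finset.sum_sub_distrib]
      simp only [hU, Set.mem_compl_iff, Set.mem_ofPred_eq, not_le] at hS'
      have h3 : n * (α + τ) < |∑ i, g (S i) - n * ∫ x, g x ∂q| := by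
        have : |∑ i, g (S i) - n * ∫ x, g x ∂q| =
            n * |(∫ x, g x ∂q) - 1 / (n : ℝ) * ∑ i, g (S i)| := by
          rw [← abs_of_pos hn', ← abs_mul, abs_of_pos hn', abs_sub_comm]
          congr 1
          field_simp
        rw [this]
        gcongr
      have h4 := abs_sub_le (∑ i, g (S i)) (∑ i, g (S' i)) (n * ∫ x, g x ∂q)
      linarith
    have h5 : (1 : ℝ≥0∞) ≤ 2⁻¹ + ν (Prod.mk S ⁻¹' B') := by
      calc (1 : ℝ≥0∞) = ν (U ∪ Uᶜ) := by rw [Set.union_compl_self, measure_univ]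
        _ ≤ ν U + ν Uᶜ := measure_union_le _ _
        _ ≤ _ := add_le_add hUle (measure_mono hsub)
    rw [← ENNReal.inv_two_add_inv_two] at h5
    exact (ENNReal.add_le_add_iff_left (by simp)).1 h5
  have h3 := mul_meas_ge_le_lintegral (μ := ν) (measurable_measure_prodMk_left (ν := ν) hB'm) 2⁻¹
  rw [h1] at h3
  calc _ ≤ ν {S | 2⁻¹ ≤ ν (Prod.mk S ⁻¹' B')} := measure_mono h2
    _ = 2 * (2⁻¹ * ν {S | 2⁻¹ ≤ ν (Prod.mk S ⁻¹' B')}) := by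
        rw [← mul_assoc, ENNReal.mul_inv_cancel (by simp) (by simp), one_mul]
    _ ≤ _ := by gcongr

/-! ### Exponential decay against quasipolynomial growth. -/

open Filter Asymptotics in
theorem exists_quasipolynomial_mul_exp_le (D K : ℕ) {c δ : ℝ} (hc : 0 < c) (hδ : 0 < δ) :
    ∃ m : ℕ, ∀ n : ℕ, m ≤ n → ∃ k : ℕ, (2 * n + 1) ^ D < 2 ^ k ∧
      ((2 * n + 1 : ℝ) ^ k) ^ K * (2 * Real.exp (-(n * c))) ≤ δ := by
  have hx : Tendsto (fun n : ℕ => (2 * n + 1 : ℝ)) atTop atTop :=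
    tendsto_atTop_add_const_right _ _
      (tendsto_natCast_atTop_atTop.const_mul_atTop two_pos)
  have h1 : (fun x : ℝ => 2 * K * D * Real.log x ^ 2 + K * (D + 1) * Real.log x ^ 1) =o[atTop] id :=
    (Real.isLittleO_pow_log_id_atTop.const_mul_left _).add
      (Real.isLittleO_pow_log_id_atTop.const_mul_left _)
  have h2 := hx.eventually (h1.bound (c := c / 6) (by positivity))
  have h3 : Tendsto (fun n : ℕ => 2 * Real.exp (c / 6 - n * (2 * c / 3))) atTop (nhds (2 * 0)) := by
    refine (Real.tendsto_exp_atBot.comp ?_).const_mul 2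
    refine tendsto_atBot_add_const_left _ _ (tendsto_neg_atTop_atBot.comp ?_)
    exact tendsto_natCast_atTop_atTop.atTop_mul_const (by positivity)
  rw [mul_zero] at h3
  obtain ⟨m, hm⟩ := eventually_atTop.1 (h2.and (h3.eventually (eventually_le_nhds hδ)))
  -- This `k` is of order `D log n`, so the logarithm of the cover size is of order `log² n = o(n)`.
  refine ⟨m, fun n hn => ⟨D * (Nat.log 2 (2 * n + 1) + 1) + 1, ?_, ?_⟩⟩
  · calc (2 * n + 1) ^ D ≤ (2 ^ (Nat.log 2 (2 * n + 1) + 1)) ^ D :=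
          Nat.pow_le_pow_left (Nat.lt_pow_succ_log_self one_lt_two _).le _
      _ = 2 ^ (D * (Nat.log 2 (2 * n + 1) + 1)) := by rw [← pow_mul, mul_comm]
      _ < _ := Nat.pow_lt_pow_right one_lt_two (Nat.lt_succ_self _)
  · obtain ⟨h4, h5⟩ := hm n hn
    set x : ℝ := 2 * n + 1 with hxdef
    have hx1 : 1 ≤ x := by rw [hxdef]; linarith [(Nat.cast_nonneg n : (0 : ℝ) ≤ n)]
    have hL : 0 ≤ Real.log x := Real.log_nonneg hx1
    have hlog : (Nat.log 2 (2 * n + 1) : ℝ) ≤ 2 * Real.log x := by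
      have h6 : ((2 : ℕ) : ℝ) ^ Nat.log 2 (2 * n + 1) ≤ x := by
        rw [hxdef]
        exact_mod_cast Nat.pow_log_le_self 2 (by omega : 2 * n + 1 ≠ 0)
      have h7 := Real.log_le_log (by positivity) h6
      rw [Real.log_pow] at h7
      have h8 := Real.log_two_gt_d9
      push_cast at h7
      have h9 : (0 : ℝ) ≤ Nat.log 2 (2 * n + 1) := Nat.cast_nonneg _
      nlinarith
    have h6 : (x ^ (D * (Nat.log 2 (2 * n + 1) + 1) + 1)) ^ K =
        Real.exp (((D * (Nat.log 2 (2 * n + 1) + 1) + 1) * K) * Real.log x) := by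
      rw [← pow_mul, ← Real.exp_log (show 0 < x ^ _ by positivity), Real.log_pow]
      push_cast
      rfl
    have h7 : ((D * (Nat.log 2 (2 * n + 1) + 1) + 1 : ℝ) * K) * Real.log x ≤ c / 6 * x := by
      calc ((D * (Nat.log 2 (2 * n + 1) + 1) + 1 : ℝ) * K) * Real.log x
          ≤ ((D * (2 * Real.log x + 1) + 1 : ℝ) * K) * Real.log x := by gcongr
        _ = 2 * K * D * Real.log x ^ 2 + K * (D + 1) * Real.log x ^ 1 := by ring
        _ ≤ _ := (le_abs_self _).trans (by
            simpa [abs_of_nonneg (zero_le_one.trans hx1)] using h4)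
    rw [h6, mul_left_comm, ← Real.exp_add]
    refine le_trans ?_ h5
    gcongr
    rw [hxdef] at h7 ⊢
    linarith

/-! ### Sufficiency of finite dimension and conclusion. -/

/-- A bounded class without large families shattered at a gap above `γ` satisfies
`γ`-uniform convergence. -/
theorem uniformConvergence_of_not_levelShatters {Ω : Type*} (𝒜 : MeasurableSpace Ω)
    {G : Set (Ω → ℝ)} {R γ : ℝ} (hR : 0 ≤ R) (hG : ∀ g ∈ G, ∀ x, |g x| ≤ R) (hγ : 0 < γ)
    (hD : ∀ γ' : ℝ, γ < γ' → ∃ D : ℕ, ∀ (s : ℝ) (x : Fin D → Ω),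
      ¬ LevelShatters G s (s + γ') x) :
    UniformConvergence 𝒜 G γ := by
  intro ε hε δ hδ
  -- The four quarters of `ε` pay for the gap above `γ`, the level spacing, the Hoeffding deviation
  -- and the ghost sample.
  obtain ⟨D, hD⟩ := hD (γ + ε / 4) (by linarith)
  set η := ε / 4 with hη
  have hη0 : 0 < η := by positivity
  obtain ⟨m, hm⟩ := exists_quasipolynomial_mul_exp_le D (⌈2 * R / η⌉₊ + 1)
    (c := η ^ 2 / (2 * (2 * (R + η)) ^ 2)) (δ := δ / 2) (by positivity) (by positivity)
  obtain ⟨m', hm'⟩ := exists_nat_gt (2 * R ^ 2 / η ^ 2)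
  refine ⟨max m (m' + 1), fun q hq hadm n hn => ?_⟩
  have hn1 : m ≤ n := (le_max_left _ _).trans hn
  have hn2 : m' + 1 ≤ n := (le_max_right _ _).trans hn
  have hn0 : 0 < n := by omega
  have hn0' : (0 : ℝ) < n := by exact_mod_cast hn0
  obtain ⟨k, hk, hkδ⟩ := hm n hn1
  have hnR : R ^ 2 / (n * η ^ 2) ≤ 1 / 2 := by
    have h1 : 2 * R ^ 2 / η ^ 2 ≤ n := hm'.le.trans (by exact_mod_cast (by omega : m' ≤ n))
    rw [div_le_iff₀ (by positivity)] at h1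
    rw [div_le_iff₀ (by positivity)]
    linarith
  have h1 := measure_supDeviation_le hadm hG hn0 (α := γ + η + η + η) (τ := η) (by positivity)
    hη0 hnR
  rw [show γ + η + η + η + η = γ + ε by rw [hη]; ring] at h1
  have h2 := measure_signedDeviationSet_le hadm (θ := n * (γ + η + η + η)) (by positivity)
    (δ / 2) fun z A hA => by
      refine (card_signed_deviation_le G R (γ + η) η η hG hR (by positivity) hη0 hη0 D hD n z k hk
        A hA).trans ?_
      calc _ = 2 ^ n * (((2 * n + 1 : ℝ) ^ k) ^ (⌈2 * R / η⌉₊ + 1) *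
            (2 * Real.exp (-(n * (η ^ 2 / (2 * (2 * (R + η)) ^ 2)))))) := by ring
        _ ≤ _ := by gcongr
  refine h1.trans ((mul_le_mul_right h2 2).trans (le_of_eq ?_))
  rw [← ENNReal.ofReal_ofNat, ← ENNReal.ofReal_mul (by norm_num)]
  congr 1
  ring

theorem mainTheorem6 {X : Type*} (𝒜 : MeasurableSpace X)
    (h𝒜 : ∀ x : X, MeasurableSet[𝒜] {x})
    (F : Set (X → ℝ)) (R : ℝ) (hF : ∀ f ∈ F, ∀ x : X, f x ∈ Set.Icc (-R) R)
    (γ : ℝ) (hγ : 0 < γ) (hUC : UniformConvergence 𝒜 F γ)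
    (ℬ : MeasurableSpace F) :
    UniformConvergence ℬ (dualClass F) γ := by
  have : MeasurableSingletonClass X := ⟨h𝒜⟩
  have hF' : ∀ f ∈ F, ∀ x, |f x| ≤ |R| := fun f hf x =>
    (abs_le.2 (hF f hf x)).trans (le_abs_self R)
  refine uniformConvergence_of_not_levelShatters ℬ (abs_nonneg R) ?_ hγ fun γ' hγ' => ?_
  · rintro _ ⟨x, rfl⟩ f
    exact hF' f f.2 x
  · obtain ⟨d, hd⟩ := hUC.exists_not_levelShatters 𝒜 hF' hγ hγ'
    -- Dual dimension `2 ^ d`, one function for each pattern on `d` points.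
    refine ⟨Fintype.card (Fin d → Bool), fun s f hf => ?_⟩
    obtain ⟨x, hx⟩ := (hf.comp (Fintype.equivFin _) (Equiv.injective _)).of_dualClass
    exact hd s x hx
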